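/- Let $d\ge 1$ and $N\ge 0$ be integers and let $\rho$ be a radially symmetric probability measure on $\mathbb{R}^d$, i.e. $R_\#\rho=\rho$ for every linear isometry $R$ of $\mathbb{R}^d$ (for instance $\rho(x)\,dx$ with a probability density depending only on $|x|$). Let $\lambda=|\cdot|_\#\rho$, a probability measure on $\mathbb{R}_+=[0,\infty)$. For a probability measure $\mu$ on $X$ let $\Pi_N(\mu)$ be the set of probability measures on $X^N$ all of whose $N$ marginals equal $\mu$. Let $$c(x_1,\dots,x_N)=\sum_{1\le i<j\le N}\frac1{|x_i-x_j|}\in[0,\infty]\quad(1/0=\infty),\qquad \tilde c(r_1,\dots,r_N)=\inf\{c(x_1,\dots,x_N): x_i\in\mathbb{R}^d,\ |x_i|=r_i \text{ for } i=1,\dots,N\}$$ for $x_i\in\mathbb{R}^d$ and $r_i\in\mathbb{R}_+$. Then $$\inf_{\gamma\in\Pi_N(\rho)}\int_{(\mathbb{R}^{d})^N} c\,d\gamma=\inf_{\tilde\gamma\in\Pi_N(\lambda)}\int_{\mathbb{R}_+^N}\tilde c\,d\tilde\gamma .$$ Moreover, assume that $\rho$ is absolutely continuous with respect to Lebesgue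 measure or, more generally, only that this common value is finite. Then, for every $\gamma\in\Pi_N(\rho)$, $\gamma$ is a minimizer of the first problem if and only if its radial component $\tilde\gamma$, the image of $\gamma$ under $(x_1,\dots,x_N)\mapsto(|x_1|,\dots,|x_N|)$, is a minimizer of the second problem and $c(x_1,\dots,x_N)=\tilde c(|x_1|,\dots,|x_N|)$ for $\gamma$-almost every $(x_1,\dots,x_N)$. -/

import Mathlib

open MeasureTheory
open scoped ENNReal NNReal

/-- `ℝ^d` with its Euclidean norm. -/
abbrev RSpace (d : ℕ) : Type := EuclideanSpace ℝ (Fin d)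

/-- `Π(μ, …, μ)`: the probability measures on `X^N` all of whose `N` marginals equal `μ`. -/
def transportPlans {X : Type*} [MeasurableSpace X] (N : ℕ) (μ : Measure X) :
    Set (Measure (Fin N → X)) :=
  {γ | IsProbabilityMeasure γ ∧ ∀ i : Fin N, γ.map (fun x => x i) = μ}

/-- The value of the multi-marginal optimal transport problem with cost `c` and all `N`
marginals equal to `μ`. -/
noncomputable def transportValue {X : Type*} [MeasurableSpace X] (N : ℕ) (μ : Measure X)
    (c : (Fin N → X) → ℝ≥0∞) : ℝ≥0∞ :=
  ⨅ γ ∈ transportPlans N μ, ∫⁻ x, c x ∂γ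

/-- `γ` solves the multi-marginal optimal transport problem with cost `c` and all `N`
marginals equal to `μ`. -/
def IsOptimalPlan {X : Type*} [MeasurableSpace X] (N : ℕ) (μ : Measure X)
    (c : (Fin N → X) → ℝ≥0∞) (γ : Measure (Fin N → X)) : Prop :=
  γ ∈ transportPlans N μ ∧
    ∀ γ' ∈ transportPlans N μ, ∫⁻ x, c x ∂γ ≤ ∫⁻ x, c x ∂γ'

/-- The Coulomb cost `∑_{i < j} 1 / |x_i - x_j|`, with values in `[0, ∞]` and `1 / 0 = ∞`. -/
noncomputable def coulombCost (d N : ℕ) (x : Fin N → RSpace d) : ℝ≥0∞ :=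
  ∑ i : Fin N, ∑ j ∈ Finset.Ioi i, 1 / ENNReal.ofReal ‖x i - x j‖

/-- The reduced cost `c̃(r_1, …, r_N) = inf {c(x_1, …, x_N) : |x_1| = r_1, …, |x_N| = r_N}`. -/
noncomputable def reducedCost (d N : ℕ) (r : Fin N → ℝ≥0) : ℝ≥0∞ :=
  sInf (coulombCost d N '' {x | ∀ i, ‖x i‖₊ = r i})

/-- A measure on `ℝ^d` is radially symmetric if every linear isometry of `ℝ^d` preserves it. -/
def IsRadialMeasure {d : ℕ} (ρ : Measure (RSpace d)) : Prop :=
  ∀ R : RSpace d ≃ₗᵢ[ℝ] RSpace d, ρ.map R = ρ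

/-- `λ = |·|_# ρ`, a measure on `ℝ_+ = [0, ∞)`. -/
noncomputable def radialMarginal {d : ℕ} (ρ : Measure (RSpace d)) : Measure ℝ≥0 :=
  ρ.map (fun x => ‖x‖₊)

/-- The radial component of `γ`: its image under `(x_1, …, x_N) ↦ (|x_1|, …, |x_N|)`. -/
noncomputable def radialComponent {d N : ℕ} (γ : Measure (Fin N → RSpace d)) :
    Measure (Fin N → ℝ≥0) :=
  γ.map (fun x i => ‖x i‖₊)

/-! Forgetting directions costs nothing: `reducedCost` of the norms bounds `coulombCost` from below,
and norms carry plans for `ρ` to plans for its radial marginal. Conversely, pick measurably a nearly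
optimal configuration for each vector of radii and apply one Haar-random rotation to all its points
at once. The cost is unchanged, while each marginal becomes rotation invariant with the right radial
marginal, hence equal to `ρ` (`exists_randomRotation`, `exists_transportPlan_lintegral_le`).

When the common value is finite, equal integrals of two ordered costs force equality almost
everywhere, which yields the characterization of minimizers. Absolute continuity gives finiteness:
the radial marginal has no atoms, so `exists_separated_transportPlan` keeps the radii uniformly
apart and the reduced cost bounded. -/

/-! ### Averaging over the orthogonal group. -/

theorem exists_isMulLeftInvariant_probabilityMeasure_unitary {E : Type*} [NormedAddCommGroup E]
    [InnerProductSpace ℝ E] [FiniteDimensional ℝ E] [CompleteSpace E] :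
    ∃ μ : Measure (unitary (E →L[ℝ] E)), IsProbabilityMeasure μ ∧ μ.IsMulLeftInvariant := by
  have : ContinuousStar (E →L[ℝ] E) :=
    ⟨(ContinuousLinearMap.adjoint : (E →L[ℝ] E) ≃ₗᵢ⋆[ℝ] (E →L[ℝ] E)).continuous⟩
  have : IsTopologicalGroup (unitary (E →L[ℝ] E)) := inferInstance
  have : CompactSpace (unitary (E →L[ℝ] E)) := by
    have : ProperSpace (E →L[ℝ] E) := FiniteDimensional.proper_real _
    refine isCompact_iff_compactSpace.mp
      ((isCompact_closedBall (0 : E →L[ℝ] E) 1).of_isClosed_subset isClosed_unitary ?_)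
    intro u hu
    rw [mem_closedBall_zero_iff]
    exact ContinuousLinearMap.opNorm_le_bound _ zero_le_one fun x => by
      rw [Unitary.norm_map ⟨u, hu⟩ x, one_mul]
  refine ⟨Measure.haarMeasure ⊤, ⟨?_⟩, inferInstance⟩
  rw [← TopologicalSpace.PositiveCompacts.coe_top]
  exact Measure.haarMeasure_self

/-- A reflection takes `y` to `x`. Acting by `g⁻¹` turns it into a left translation of `g`, so left
invariance suffices. -/
theorem lintegral_unitary_inv_apply_eq_of_norm_eq {E : Type*} [NormedAddCommGroup E]
    [InnerProductSpace ℝ E] [CompleteSpace E] (μ : Measure (unitary (E →L[ℝ] E)))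
    [μ.IsMulLeftInvariant] (f : E → ℝ≥0∞) {x y : E} (hxy : ‖x‖ = ‖y‖) :
    ∫⁻ g, f (((g⁻¹ : unitary (E →L[ℝ] E)) : E →L[ℝ] E) x) ∂μ =
      ∫⁻ g, f (((g⁻¹ : unitary (E →L[ℝ] E)) : E →L[ℝ] E) y) ∂μ := by
  set R : unitary (E →L[ℝ] E) :=
    Unitary.linearIsometryEquiv.symm ((ℝ ∙ (y - x))ᗮ.reflection)
  have hRy : (R : E →L[ℝ] E) y = x := Submodule.reflection_sub hxy.symm
  rw [← lintegral_mul_left_eq_self _ R]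
  refine lintegral_congr fun g => ?_
  have : ((R * g)⁻¹ : unitary (E →L[ℝ] E)) * R = g⁻¹ := by group
  rw [← hRy, ← this]
  rfl

section Averaging

variable {E : Type*} [NormedAddCommGroup E] [InnerProductSpace ℝ E] [FiniteDimensional ℝ E]
  [CompleteSpace E] [MeasurableSpace E] [BorelSpace E]

theorem measurable_unitary_inv_apply :
    Measurable fun p : unitary (E →L[ℝ] E) × E => ((p.1⁻¹ : unitary (E →L[ℝ] E)) : E →L[ℝ] E) p.2 := by
  have : ProperSpace E := FiniteDimensional.proper_real _
  have : ContinuousStar (E →L[ℝ] E) :=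
    ⟨(ContinuousLinearMap.adjoint : (E →L[ℝ] E) ≃ₗᵢ⋆[ℝ] (E →L[ℝ] E)).continuous⟩
  have h : Continuous fun p : unitary (E →L[ℝ] E) × E =>
    ((p.1⁻¹ : unitary (E →L[ℝ] E)) : E →L[ℝ] E) p.2 := by fun_prop
  exact h.measurable

/-- The average of a test function over rotations depends only on the norm, so `ν` may be replaced
by `ρ`, which every rotation fixes. -/
theorem map_unitary_inv_apply_eq [Nontrivial E] (μ : Measure (unitary (E →L[ℝ] E)))
    [IsProbabilityMeasure μ] [μ.IsMulLeftInvariant] {ρ ν : Measure E} [SFinite ρ] [SFinite ν]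
    (hρ : ∀ R : E ≃ₗᵢ[ℝ] E, ρ.map R = ρ)
    (hν : ν.map (fun x => ‖x‖₊) = ρ.map (fun x => ‖x‖₊)) :
    (μ.prod ν).map (fun p => ((p.1⁻¹ : unitary (E →L[ℝ] E)) : E →L[ℝ] E) p.2) = ρ := by
  obtain ⟨e, he⟩ := exists_norm_eq E (zero_le_one (α := ℝ))
  ext S hS
  have hf : Measurable (S.indicator (1 : E → ℝ≥0∞)) := measurable_one.indicator hS
  set f := S.indicator (1 : E → ℝ≥0∞)
  have hF : Measurable fun p : unitary (E →L[ℝ] E) × E =>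
      f (((p.1⁻¹ : unitary (E →L[ℝ] E)) : E →L[ℝ] E) p.2) :=
    hf.comp measurable_unitary_inv_apply
  set B : ℝ≥0 → ℝ≥0∞ := fun r =>
    ∫⁻ g, f (((g⁻¹ : unitary (E →L[ℝ] E)) : E →L[ℝ] E) ((r : ℝ) • e)) ∂μ
  have hB : Measurable B := by
    have h1 : Measurable fun x : E =>
        ∫⁻ g, f (((g⁻¹ : unitary (E →L[ℝ] E)) : E →L[ℝ] E) x) ∂μ := hF.lintegral_prod_left'
    exact h1.comp (by fun_prop : Measurable fun r : ℝ≥0 => (r : ℝ) • e)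
  have key : ∀ τ : Measure E, SFinite τ →
      ∫⁻ p, f (((p.1⁻¹ : unitary (E →L[ℝ] E)) : E →L[ℝ] E) p.2) ∂(μ.prod τ) =
        ∫⁻ r, B r ∂(τ.map fun x => ‖x‖₊) := by
    intro τ hτ
    rw [lintegral_prod_symm _ hF.aemeasurable, lintegral_map hB measurable_nnnorm]
    refine lintegral_congr fun x => lintegral_unitary_inv_apply_eq_of_norm_eq μ f ?_
    simp [norm_smul, he]
  rw [← lintegral_indicator_one hS, lintegral_map hf measurable_unitary_inv_apply, key ν ‹_›, hν,
    ← key ρ ‹_›, lintegral_prod _ hF.aemeasurable]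
  have hinner : ∀ g : unitary (E →L[ℝ] E),
      ∫⁻ x, f (((g⁻¹ : unitary (E →L[ℝ] E)) : E →L[ℝ] E) x) ∂ρ = ρ S := by
    intro g
    have h := hρ (Unitary.linearIsometryEquiv g⁻¹)
    conv_rhs => rw [← lintegral_indicator_one hS, ← h,
      lintegral_map hf (LinearIsometryEquiv.continuous _).measurable]
    rfl
  simp [hinner]

/-- A random rotation that turns every measure into the radial measure with the same radial
marginal. -/
theorem exists_randomRotation.{u} (E : Type u) [NormedAddCommGroup E] [InnerProductSpace ℝ E]
    [FiniteDimensional ℝ E] [CompleteSpace E] [MeasurableSpace E] [BorelSpace E] [Nontrivial E] :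
    ∃ (Ω : Type u) (_ : MeasurableSpace Ω) (P : Measure Ω) (R : Ω → E →L[ℝ] E),
      IsProbabilityMeasure P ∧ (Measurable fun p : Ω × E => R p.1 p.2) ∧ (∀ ω x, ‖R ω x‖ = ‖x‖) ∧
        ∀ ρ ν : Measure E, SFinite ρ → SFinite ν → (∀ S : E ≃ₗᵢ[ℝ] E, ρ.map S = ρ) →
          ν.map (fun x => ‖x‖₊) = ρ.map (fun x => ‖x‖₊) →
            (P.prod ν).map (fun p => R p.1 p.2) = ρ := by
  obtain ⟨μ, hμ, hμi⟩ := exists_isMulLeftInvariant_probabilityMeasure_unitary (E := E)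
  exact ⟨unitary (E →L[ℝ] E), inferInstance, μ,
    fun g => ((g⁻¹ : unitary (E →L[ℝ] E)) : E →L[ℝ] E), hμ,
    measurable_unitary_inv_apply, fun g x => Unitary.norm_map g⁻¹ x,
    fun ρ ν _ _ hρ hν => map_unitary_inv_apply_eq μ hρ hν⟩

end Averaging

/-! ### The two costs and measurable selection. -/

theorem continuous_coulombCost (d N : ℕ) : Continuous (coulombCost d N) := by
  unfold coulombCost
  simp only [one_div]
  refine continuous_finsetSum _ fun i _ => continuous_finsetSum _ fun j _ => ?_
  exact (ENNReal.continuous_ofReal.comp (by fun_prop)).inv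

theorem coulombCost_linearIsometry {d N : ℕ} (g : RSpace d →L[ℝ] RSpace d)
    (hg : ∀ x, ‖g x‖ = ‖x‖) (x : Fin N → RSpace d) :
    coulombCost d N (fun i => g (x i)) = coulombCost d N x := by
  simp only [coulombCost, ← map_sub, hg]

theorem reducedCost_le_coulombCost {d N : ℕ} (x : Fin N → RSpace d) :
    reducedCost d N (fun i => ‖x i‖₊) ≤ coulombCost d N x :=
  sInf_le ⟨x, fun _ => rfl, rfl⟩

section Selection

variable {d : ℕ} [Nonempty (Fin d)] (N : ℕ)

/-- The cost is continuous into `[0, ∞]` even at collisions, so countably many dense directions,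
independent of `r`, compute the infimum. -/
theorem exists_dense_directions : ∃ u : ℕ → Fin N → RSpace d, (∀ n i, ‖u n i‖ = 1) ∧
    ∀ r, reducedCost d N r = ⨅ n, coulombCost d N (fun i => (r i : ℝ) • u n i) := by
  have : Nonempty (Metric.sphere (0 : RSpace d) 1) :=
    (NormedSpace.sphere_nonempty.mpr zero_le_one).to_subtype
  let v := TopologicalSpace.denseSeq (Fin N → Metric.sphere (0 : RSpace d) 1)
  have hv : DenseRange v := TopologicalSpace.denseRange_denseSeq _
  refine ⟨fun n i => v n i, fun n i => by simp, fun r => le_antisymm ?_ ?_⟩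
  · refine le_iInf fun n => sInf_le ⟨_, fun i => ?_, rfl⟩
    exact NNReal.eq (by simp [norm_smul])
  · refine le_sInf ?_
    rintro _ ⟨x, hx, rfl⟩
    have hw : ∀ i, ∃ w : Metric.sphere (0 : RSpace d) 1, (r i : ℝ) • (w : RSpace d) = x i := by
      intro i
      by_cases h : x i = 0
      · refine ⟨Classical.arbitrary _, ?_⟩
        rw [← hx i, h]; simp
      · refine ⟨⟨‖x i‖⁻¹ • x i, ?_⟩, ?_⟩
        · simp [norm_smul, h]
        · rw [← hx i]; simp [smul_smul, h]
    choose w hw using hw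
    have hcont : Continuous fun y : Fin N → Metric.sphere (0 : RSpace d) 1 =>
        coulombCost d N (fun i => (r i : ℝ) • (y i : RSpace d)) :=
      (continuous_coulombCost d N).comp (by fun_prop)
    have hcl : IsClosed {y : Fin N → Metric.sphere (0 : RSpace d) 1 |
        (⨅ n, coulombCost d N (fun i => (r i : ℝ) • (v n i : RSpace d))) ≤
          coulombCost d N (fun i => (r i : ℝ) • (y i : RSpace d))} :=
      isClosed_le continuous_const hcont
    have := hv.induction_on (p := fun y => (⨅ n, coulombCost d N
        (fun i => (r i : ℝ) • (v n i : RSpace d))) ≤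
          coulombCost d N (fun i => (r i : ℝ) • (y i : RSpace d))) w hcl
      (fun n => iInf_le _ n)
    simpa only [hw] using this

theorem measurable_reducedCost : Measurable (reducedCost d N) := by
  obtain ⟨u, -, hu⟩ := exists_dense_directions (d := d) N
  rw [funext hu]
  exact Measurable.iInf fun n => (continuous_coulombCost d N).measurable.comp (by fun_prop)

theorem exists_measurable_almost_minimizer {ε : ℝ≥0∞} (hε : ε ≠ 0) :
    ∃ X : (Fin N → ℝ≥0) → Fin N → RSpace d, Measurable X ∧ (∀ r i, ‖X r i‖₊ = r i) ∧
      ∀ r, coulombCost d N (X r) ≤ reducedCost d N r + ε := by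
  classical
  obtain ⟨u, hu1, hu⟩ := exists_dense_directions (d := d) N
  have hex : ∀ r, ∃ n, coulombCost d N (fun i => (r i : ℝ) • u n i) ≤ reducedCost d N r + ε := by
    intro r
    by_cases h : reducedCost d N r = ∞
    · exact ⟨0, by simp [h]⟩
    · have : ⨅ n, coulombCost d N (fun i => (r i : ℝ) • u n i) < reducedCost d N r + ε := by
        rw [← hu]; exact ENNReal.lt_add_right h hε
      obtain ⟨n, hn⟩ := iInf_lt_iff.mp this
      exact ⟨n, hn.le⟩
  have hm : ∀ n, Measurable fun r : Fin N → ℝ≥0 => fun i => (r i : ℝ) • u n i := by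
    intro n; fun_prop
  -- Taking the first admissible index makes the choice measurable.
  refine ⟨fun r i => (r i : ℝ) • u (Nat.find (hex r)) i, ?_, fun r i => ?_,
    fun r => Nat.find_spec (hex r)⟩
  · refine Measurable.find hm (fun n => ?_) hex
    exact measurableSet_le ((continuous_coulombCost d N).measurable.comp (hm n))
      ((measurable_reducedCost N).add_const ε)
  · exact NNReal.eq (by simp [norm_smul, hu1])

end Selection

/-! ### Distribution and quantile functions of atomless measures. -/

section Quantile

open ProbabilityTheory Filter Topology

variable (ν : Measure ℝ) [IsProbabilityMeasure ν]

theorem continuous_cdf_of_measure_singleton (hν : ∀ x, ν {x} = 0) : Continuous (cdf ν) := by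
  refine continuous_iff_continuousAt.mpr fun x => ?_
  rw [(monotone_cdf ν).continuousAt_iff_leftLim_eq_rightLim, StieltjesFunction.rightLim_eq]
  have h := (cdf ν).measure_singleton x
  rw [measure_cdf, hν, eq_comm, ENNReal.ofReal_eq_zero] at h
  exact le_antisymm ((monotone_cdf ν).leftLim_le le_rfl) (by linarith)

theorem uniformContinuous_cdf_of_measure_singleton (hν : ∀ x, ν {x} = 0) :
    UniformContinuous (cdf ν) := by
  have hc := continuous_cdf_of_measure_singleton ν hν
  have hm := monotone_cdf ν
  rw [Metric.uniformContinuous_iff]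
  intro ε hε
  obtain ⟨A, hA⟩ := ((tendsto_cdf_atBot ν).eventually (gt_mem_nhds (by positivity : 0 < ε / 3))).exists
  obtain ⟨B, hB⟩ := ((tendsto_cdf_atTop ν).eventually
    (lt_mem_nhds (by linarith : 1 - ε / 3 < 1))).exists
  -- Clamping to a compact interval is 1-Lipschitz and barely changes the cdf; `min A B` is used
  -- because `A ≤ B` is not known.
  have hclose : ∀ x, |cdf ν x - cdf ν (max (min A B) (min B x))| < ε / 3 := by
    intro x
    have h0 := cdf_nonneg ν x
    have h1 := cdf_le_one ν x
    have hAB : cdf ν (min A B) ≤ cdf ν A := hm (min_le_left _ _)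
    have hAB0 := cdf_nonneg ν (min A B)
    have hB1 := cdf_le_one ν B
    rw [abs_lt]
    rcases le_total B x with hx | hx
    · rw [min_eq_left hx, max_eq_right (min_le_right _ _)]
      have := hm hx
      constructor <;> linarith
    · rw [min_eq_right hx]
      rcases le_total (min A B) x with hx' | hx'
      · rw [max_eq_right hx']
        constructor <;> linarith
      · rw [max_eq_left hx']
        have := hm hx'
        constructor <;> linarith
  obtain ⟨δ, hδ, h⟩ := Metric.uniformContinuousOn_iff.mp
    ((isCompact_Icc (a := min A B) (b := B)).uniformContinuousOn_of_continuous hc.continuousOn)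
    (ε / 3) (by positivity)
  refine ⟨δ, hδ, fun {x y} hxy => ?_⟩
  have hmem : ∀ x, max (min A B) (min B x) ∈ Set.Icc (min A B) B := fun x =>
    ⟨le_max_left _ _, max_le (min_le_right _ _) (min_le_left _ _)⟩
  have hlip : dist (max (min A B) (min B x)) (max (min A B) (min B y)) ≤ dist x y := by
    simp only [Real.dist_eq]
    refine (abs_max_sub_max_le_max _ _ _ _).trans ?_
    simpa using abs_min_sub_min_le_max B x B y
  have h3 := h _ (hmem x) _ (hmem y) (hlip.trans_lt hxy)
  have h1 := hclose x
  have h2 := hclose y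
  rw [Real.dist_eq, abs_lt] at h3 ⊢
  rw [abs_lt] at h1 h2
  constructor <;> linarith

/-- Any right inverse of the continuous cdf is monotone on `(0, 1)`; there the preimage of `Iic x`
lies between `(0, cdf ν x)` and `(0, cdf ν x]`. -/
theorem exists_quantile (hν : ∀ x, ν {x} = 0) :
    ∃ q : ℝ → ℝ, (∀ t ∈ Set.Ioo (0 : ℝ) 1, cdf ν (q t) = t) ∧
      AEMeasurable q (volume.restrict (Set.Ioo 0 1)) ∧
      (volume.restrict (Set.Ioo 0 1)).map q = ν := by
  have hc := continuous_cdf_of_measure_singleton ν hν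
  have hm := monotone_cdf ν
  have hex : ∀ t : ℝ, ∃ x, t ∈ Set.Ioo (0 : ℝ) 1 → cdf ν x = t := by
    intro t
    by_cases ht : t ∈ Set.Ioo (0 : ℝ) 1
    · obtain ⟨A, hA⟩ := ((tendsto_cdf_atBot ν).eventually (gt_mem_nhds ht.1)).exists
      obtain ⟨B, hB⟩ := ((tendsto_cdf_atTop ν).eventually (lt_mem_nhds ht.2)).exists
      obtain ⟨x, hx⟩ := mem_range_of_exists_le_of_exists_ge hc ⟨A, hA.le⟩ ⟨B, hB.le⟩
      exact ⟨x, fun _ => hx⟩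
    · exact ⟨0, fun h => absurd h ht⟩
  choose q hq using hex
  have hmono : MonotoneOn q (Set.Ioo 0 1) := by
    intro s hs t ht hst
    by_contra! h
    have h2 := hm h.le
    rw [hq s hs, hq t ht] at h2
    rw [le_antisymm hst h2] at h
    exact lt_irrefl _ h
  have hae : AEMeasurable q (volume.restrict (Set.Ioo 0 1)) :=
    aemeasurable_restrict_of_monotoneOn measurableSet_Ioo hmono
  refine ⟨q, hq, hae, ?_⟩
  have hprob : IsProbabilityMeasure (volume.restrict (Set.Ioo (0 : ℝ) 1)) := ⟨by simp⟩
  have := Measure.isProbabilityMeasure_map hae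
  refine Measure.ext_of_Iic _ _ fun x => ?_
  rw [Measure.map_apply_of_aemeasurable hae measurableSet_Iic, ← ofReal_cdf ν x]
  have h0 := cdf_nonneg ν x
  have h1 := cdf_le_one ν x
  refine le_antisymm ?_ ?_
  · calc (volume.restrict (Set.Ioo 0 1)) (q ⁻¹' Set.Iic x)
        = volume (q ⁻¹' Set.Iic x ∩ Set.Ioo 0 1) := Measure.restrict_apply' measurableSet_Ioo
      _ ≤ volume (Set.Ioc 0 (cdf ν x)) := by
          refine measure_mono fun t ht => ⟨ht.2.1, ?_⟩
          rw [← hq t ht.2]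
          exact hm ht.1
      _ = ENNReal.ofReal (cdf ν x) := by simp
  · calc ENNReal.ofReal (cdf ν x) = volume (Set.Ioo 0 (cdf ν x)) := by simp
      _ ≤ volume (q ⁻¹' Set.Iic x ∩ Set.Ioo 0 1) := by
          refine measure_mono fun t ht => ?_
          have ht' : t ∈ Set.Ioo (0 : ℝ) 1 := ⟨ht.1, ht.2.trans_le h1⟩
          refine ⟨?_, ht'⟩
          by_contra h
          have h2 := hm (not_le.mp h).le
          rw [hq t ht'] at h2
          exact absurd ht.2 (not_lt.mpr h2)
      _ = _ := (Measure.restrict_apply' measurableSet_Ioo).symm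

end Quantile

/-! ### Plans with separated radii. -/

theorem one_div_le_abs_sub_of_fin_ne {N : ℕ} {i j : Fin N} (hij : i ≠ j) (x y : ℝ)
    (h : ∃ n : ℤ, x - y = (i : ℝ) / N - (j : ℝ) / N + n) : 1 / (N : ℝ) ≤ |x - y| := by
  obtain ⟨n, hn⟩ := h
  have hN : (0 : ℝ) < N := by exact_mod_cast i.pos
  -- This integer is `N * (x - y)`; it is nonzero because `|i - j| < N`.
  have hne : (i : ℤ) - j + N * n ≠ 0 := by
    intro h0
    have hd : (N : ℤ) ∣ (i : ℤ) - j := ⟨-n, by linarith⟩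
    have h1 := Int.eq_zero_of_abs_lt_dvd hd (by rw [abs_lt]; omega)
    exact hij (Fin.ext (by omega))
  have h1 : (1 : ℝ) ≤ |((i : ℤ) - j + N * n : ℤ)| := by exact_mod_cast Int.one_le_abs hne
  have h2 : (N : ℝ) * (x - y) = (((i : ℤ) - j + N * n : ℤ) : ℝ) := by
    rw [hn]; push_cast; field_simp
  rw [Int.cast_abs, ← h2, abs_mul, abs_of_pos hN] at h1
  rwa [div_le_iff₀' hN]

theorem exists_circle_quantile (l : Measure ℝ≥0) [IsProbabilityMeasure l] (hl : ∀ x, l {x} = 0) :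
    ∃ (G : UnitAddCircle → ℝ≥0) (F : ℝ → ℝ), AEMeasurable G volume ∧ volume.map G = l ∧
      UniformContinuous F ∧ ∀ᵐ t : UnitAddCircle, ((F (G t) : ℝ) : UnitAddCircle) = t := by
  set ν : Measure ℝ := l.map ((↑) : ℝ≥0 → ℝ) with hνdef
  have : IsProbabilityMeasure ν := Measure.isProbabilityMeasure_map (by fun_prop)
  have hν : ∀ x, ν {x} = 0 := by
    intro x
    rw [hνdef, Measure.map_apply (by fun_prop) (measurableSet_singleton x)]
    refine measure_mono_null (fun y hy => ?_) (hl x.toNNReal)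
    rw [← show (y : ℝ) = x from hy]
    simp
  obtain ⟨q, hq, hqm, hqν⟩ := exists_quantile ν hν
  have hq0 : ∀ t ∈ Set.Ioo (0 : ℝ) 1, 0 ≤ q t := by
    intro t ht
    by_contra! h
    have h1 := hq t ht
    rw [ProbabilityTheory.cdf_eq_real, measureReal_def, hνdef,
      Measure.map_apply (by fun_prop) measurableSet_Iic] at h1
    have h2 : ((↑) : ℝ≥0 → ℝ) ⁻¹' Set.Iic (q t) = ∅ :=
      Set.eq_empty_of_forall_notMem fun y hy => absurd y.2 (not_le.mpr (lt_of_le_of_lt hy h))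
    rw [h2] at h1
    simp only [measure_empty, ENNReal.toReal_zero] at h1
    exact ht.1.ne h1
  obtain ⟨rep, hrep, hrepcoe⟩ : ∃ rep : UnitAddCircle → ℝ,
      MeasurePreserving rep volume (volume.restrict (Set.Ioo 0 1)) ∧
        ∀ t, ((rep t : ℝ) : UnitAddCircle) = t := by
    refine ⟨fun t => (AddCircle.equivIoc 1 0 t : ℝ), ?_,
      fun t => (AddCircle.equivIoc 1 0).symm_apply_apply t⟩
    have h1 := (AddCircle.measurePreserving_equivIoc (1 : ℝ) (a := 0))
    have h2 : MeasurePreserving (Subtype.val : Set.Ioc (0 : ℝ) (0 + 1) → ℝ)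
        (Measure.comap Subtype.val volume) (volume.restrict (Set.Ioc 0 (0 + 1))) :=
      ⟨measurable_subtype_coe, map_comap_subtype_coe measurableSet_Ioc _⟩
    have h3 : (volume.restrict (Set.Ioc (0 : ℝ) (0 + 1))) = volume.restrict (Set.Ioo 0 1) := by
      rw [zero_add, restrict_Ioo_eq_restrict_Ioc]
    exact h3 ▸ h2.comp h1
  have hqrep : AEMeasurable (fun t => q (rep t)) volume :=
    hqm.comp_quasiMeasurePreserving hrep.quasiMeasurePreserving
  refine ⟨fun t => (q (rep t)).toNNReal, ProbabilityTheory.cdf ν,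
    measurable_real_toNNReal.comp_aemeasurable hqrep, ?_,
    uniformContinuous_cdf_of_measure_singleton ν hν, ?_⟩
  · have h1 : volume.map (fun t => q (rep t)) = ν := by
      rw [← hqν, ← hrep.map_eq]
      refine (AEMeasurable.map_map_of_aemeasurable ?_ hrep.aemeasurable).symm
      rwa [hrep.map_eq]
    have h2 : volume.map (fun t => (q (rep t)).toNNReal) =
        (volume.map (fun t => q (rep t))).map Real.toNNReal :=
      (AEMeasurable.map_map_of_aemeasurable measurable_real_toNNReal.aemeasurable hqrep).symm
    rw [h2, h1, hνdef, Measure.map_map measurable_real_toNNReal (by fun_prop)]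
    convert Measure.map_id
    ext x; simp
  · have hIoo : ∀ᵐ t : UnitAddCircle, rep t ∈ Set.Ioo (0 : ℝ) 1 :=
      hrep.quasiMeasurePreserving.ae (ae_restrict_mem measurableSet_Ioo)
    filter_upwards [hIoo] with t ht
    rw [Real.coe_toNNReal _ (hq0 _ ht), hq _ ht, hrepcoe]

/-- All radii come from one uniform point `t` of the circle, as quantiles at `t + i / N`. Nearby
radii would have nearby values of the uniformly continuous `F`, but these differ by at least `1 /
N`. -/
theorem exists_separated_transportPlan (N : ℕ) (l : Measure ℝ≥0) [IsProbabilityMeasure l]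
    (hl : ∀ x, l {x} = 0) : ∃ γ ∈ transportPlans N l, ∃ δ > (0 : ℝ),
      ∀ᵐ r ∂γ, ∀ i j, i ≠ j → δ ≤ |(r i : ℝ) - r j| := by
  obtain ⟨G, F, hG, hGmap, hF, hFG⟩ := exists_circle_quantile l hl
  let sh : Fin N → UnitAddCircle := fun i => ((i / N : ℝ) : UnitAddCircle)
  have hsh : ∀ i, MeasurePreserving (fun t : UnitAddCircle => t + sh i) volume volume :=
    fun i => measurePreserving_add_right volume (sh i)
  have hGi : ∀ i, AEMeasurable (fun t => G (t + sh i)) volume := fun i =>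
    hG.comp_quasiMeasurePreserving (hsh i).quasiMeasurePreserving
  have hT : AEMeasurable (fun t i => G (t + sh i)) volume := aemeasurable_pi_iff.mpr hGi
  have hvol : IsProbabilityMeasure (volume : Measure UnitAddCircle) := ⟨by simp⟩
  refine ⟨volume.map (fun t i => G (t + sh i)),
    ⟨Measure.isProbabilityMeasure_map hT, fun i => ?_⟩, ?_⟩
  · rw [AEMeasurable.map_map_of_aemeasurable (measurable_pi_apply i).aemeasurable hT]
    have h1 : volume.map (G ∘ fun t => t + sh i) = l := by
      rw [← AEMeasurable.map_map_of_aemeasurable _ (hsh i).aemeasurable, (hsh i).map_eq, hGmap]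
      rwa [(hsh i).map_eq]
    exact h1
  · rcases Nat.eq_zero_or_pos N with rfl | hN
    · exact ⟨1, one_pos, Filter.Eventually.of_forall fun r i => i.elim0⟩
    obtain ⟨δ, hδ, hunif⟩ := Metric.uniformContinuous_iff.mp hF (1 / N) (by positivity)
    refine ⟨δ, hδ, ?_⟩
    rw [ae_map_iff hT]
    · have hall : ∀ᵐ t : UnitAddCircle, ∀ i,
          ((F (G (t + sh i)) : ℝ) : UnitAddCircle) = t + sh i := by
        rw [ae_all_iff]
        intro i
        exact (hsh i).quasiMeasurePreserving.ae
          (p := fun t => ((F (G t) : ℝ) : UnitAddCircle) = t) hFG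
      filter_upwards [hall] with t ht i j hij
      by_contra! h
      have h1 := hunif (a := G (t + sh i)) (b := G (t + sh j)) h
      rw [Real.dist_eq] at h1
      refine absurd h1 (not_lt.mpr (one_div_le_abs_sub_of_fin_ne hij _ _ ?_))
      have h2 : ((F (G (t + sh i)) - F (G (t + sh j)) - ((i : ℝ) / N - (j : ℝ) / N) : ℝ) :
          UnitAddCircle) = 0 := by
        rw [AddCircle.coe_sub, AddCircle.coe_sub, AddCircle.coe_sub, ht, ht]
        simp only [sh]
        abel
      obtain ⟨n, hn⟩ := (AddCircle.coe_eq_zero_iff 1).mp h2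
      refine ⟨n, ?_⟩
      simp only [zsmul_eq_mul, mul_one] at hn
      linarith
    · simp only [Set.ofPred_forall]
      refine MeasurableSet.iInter fun i => MeasurableSet.iInter fun j =>
        MeasurableSet.iInter fun _ => measurableSet_le measurable_const ?_
      fun_prop

/-- Placing all points on one ray makes their distances the differences of radii. -/
theorem reducedCost_le_of_separated {d N : ℕ} [Nonempty (Fin d)] {r : Fin N → ℝ≥0} {δ : ℝ}
    (hr : ∀ i j, i ≠ j → δ ≤ |(r i : ℝ) - r j|) :
    reducedCost d N r ≤ N * (N * (1 / ENNReal.ofReal δ)) := by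
  obtain ⟨e, he⟩ := exists_norm_eq (RSpace d) (zero_le_one (α := ℝ))
  have hmem : ∀ i, ‖(r i : ℝ) • e‖₊ = r i := fun i => NNReal.eq (by simp [norm_smul, he])
  refine le_trans (sInf_le ⟨fun i => (r i : ℝ) • e, hmem, rfl⟩) ?_
  have hterm : ∀ i, ∀ j ∈ Finset.Ioi i,
      1 / ENNReal.ofReal ‖(r i : ℝ) • e - (r j : ℝ) • e‖ ≤ 1 / ENNReal.ofReal δ := by
    intro i j hj
    rw [← sub_smul, norm_smul, he, mul_one, Real.norm_eq_abs]
    exact ENNReal.div_le_div_left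
      (ENNReal.ofReal_le_ofReal (hr i j (Finset.mem_Ioi.mp hj).ne)) _
  calc coulombCost d N (fun i => (r i : ℝ) • e)
      ≤ ∑ i : Fin N, ∑ _j ∈ Finset.Ioi i, 1 / ENNReal.ofReal δ :=
        Finset.sum_le_sum fun i _ => Finset.sum_le_sum (hterm i)
    _ ≤ ∑ _i : Fin N, ∑ _j : Fin N, 1 / ENNReal.ofReal δ :=
        Finset.sum_le_sum fun i _ => Finset.sum_le_sum_of_subset (Finset.subset_univ _)
    _ = N * (N * (1 / ENNReal.ofReal δ)) := by simp

/-! ### Comparison of the two transport problems. -/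

section Radial

variable {d N : ℕ} {ρ : Measure (RSpace d)}

theorem measurable_nnnorm_pi :
    Measurable fun (x : Fin N → RSpace d) (i : Fin N) => ‖x i‖₊ := by fun_prop

theorem radialComponent_mem_transportPlans {γ : Measure (Fin N → RSpace d)}
    (hγ : γ ∈ transportPlans N ρ) : radialComponent γ ∈ transportPlans N (radialMarginal ρ) := by
  have := hγ.1
  refine ⟨Measure.isProbabilityMeasure_map measurable_nnnorm_pi.aemeasurable, fun i => ?_⟩
  rw [radialComponent, radialMarginal, Measure.map_map (measurable_pi_apply i) measurable_nnnorm_pi,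
    ← hγ.2 i, Measure.map_map (g := fun x : RSpace d => ‖x‖₊) measurable_nnnorm
      (measurable_pi_apply i)]
  rfl

theorem lintegral_reducedCost_radialComponent [Nonempty (Fin d)] (γ : Measure (Fin N → RSpace d)) :
    ∫⁻ r, reducedCost d N r ∂(radialComponent γ) =
      ∫⁻ x, reducedCost d N (fun i => ‖x i‖₊) ∂γ :=
  lintegral_map (measurable_reducedCost N) measurable_nnnorm_pi

theorem exists_transportPlan_lintegral_le [Nonempty (Fin d)] [IsProbabilityMeasure ρ]
    (hρ : IsRadialMeasure ρ) {η : Measure (Fin N → ℝ≥0)}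
    (hη : η ∈ transportPlans N (radialMarginal ρ)) {ε : ℝ≥0∞} (hε : ε ≠ 0) :
    ∃ γ ∈ transportPlans N ρ,
      ∫⁻ x, coulombCost d N x ∂γ ≤ ∫⁻ r, reducedCost d N r ∂η + ε := by
  have := hη.1
  obtain ⟨X, hXm, hXr, hXc⟩ := exists_measurable_almost_minimizer (d := d) N hε
  obtain ⟨Ω, _, P, R, hP, hR, hRn, hRρ⟩ := exists_randomRotation (RSpace d)
  have hXi : ∀ i, Measurable fun r => X r i := fun i => (measurable_pi_apply i).comp hXm
  have hΦi : ∀ i, Measurable fun p : Ω × (Fin N → ℝ≥0) => R p.1 (X p.2 i) := fun i =>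
    hR.comp (measurable_fst.prodMk ((hXi i).comp measurable_snd))
  have hΦ : Measurable fun (p : Ω × (Fin N → ℝ≥0)) i => R p.1 (X p.2 i) :=
    measurable_pi_lambda _ hΦi
  refine ⟨(P.prod η).map fun p i => R p.1 (X p.2 i),
    ⟨Measure.isProbabilityMeasure_map hΦ.aemeasurable, fun i => ?_⟩, ?_⟩
  · have hν : (η.map fun r => X r i).map (fun x => ‖x‖₊) = ρ.map (fun x => ‖x‖₊) := by
      rw [Measure.map_map measurable_nnnorm (hXi i)]
      refine Eq.trans ?_ (hη.2 i)
      congr 1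
      exact funext fun r => hXr r i
    have hprod : (P.prod η).map (Prod.map id fun r => X r i) = P.prod (η.map fun r => X r i) := by
      rw [← Measure.map_prod_map P η measurable_id (hXi i), Measure.map_id]
    have hmap := hRρ ρ _ inferInstance inferInstance hρ hν
    rw [← hprod, Measure.map_map hR (measurable_id.prodMap (hXi i))] at hmap
    rw [Measure.map_map (measurable_pi_apply i) hΦ]
    exact hmap
  · rw [lintegral_map (continuous_coulombCost d N).measurable hΦ]
    calc ∫⁻ p, coulombCost d N (fun i => R p.1 (X p.2 i)) ∂(P.prod η)
        ≤ ∫⁻ p, (reducedCost d N p.2 + ε) ∂(P.prod η) := by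
          refine lintegral_mono fun p => ?_
          rw [coulombCost_linearIsometry (R p.1) (hRn p.1)]
          exact hXc p.2
      _ = ∫⁻ r, reducedCost d N r ∂η + ε := by
          have hm : Measurable fun p : Ω × (Fin N → ℝ≥0) => reducedCost d N p.2 :=
            (measurable_reducedCost N).comp measurable_snd
          rw [lintegral_add_left hm, lintegral_const, measure_univ, mul_one,
            lintegral_prod _ hm.aemeasurable]
          simp

theorem transportValue_coulombCost_eq [Nonempty (Fin d)] [IsProbabilityMeasure ρ]
    (hρ : IsRadialMeasure ρ) : transportValue N ρ (coulombCost d N) =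
      transportValue N (radialMarginal ρ) (reducedCost d N) := by
  refine le_antisymm ?_ ?_
  · refine le_iInf₂ fun η hη => ENNReal.le_of_forall_pos_le_add fun ε hε _ => ?_
    obtain ⟨γ, hγ, h⟩ := exists_transportPlan_lintegral_le hρ hη (ENNReal.coe_ne_zero.mpr hε.ne')
    exact (iInf₂_le γ hγ).trans h
  · refine le_iInf₂ fun γ hγ => (iInf₂_le _ (radialComponent_mem_transportPlans hγ)).trans ?_
    rw [lintegral_reducedCost_radialComponent]
    exact lintegral_mono reducedCost_le_coulombCost

theorem transportValue_lt_top_of_absolutelyContinuous [Nonempty (Fin d)] [IsProbabilityMeasure ρ]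
    (hρ : IsRadialMeasure ρ) (hac : ρ ≪ volume) : transportValue N ρ (coulombCost d N) < ∞ := by
  rw [transportValue_coulombCost_eq hρ]
  have : IsProbabilityMeasure (radialMarginal ρ) :=
    Measure.isProbabilityMeasure_map measurable_nnnorm.aemeasurable
  have hatom : ∀ r, radialMarginal ρ {r} = 0 := by
    intro r
    rw [radialMarginal, Measure.map_apply measurable_nnnorm (measurableSet_singleton r)]
    -- An atom of the radial marginal would be mass on a Lebesgue-null sphere.
    refine hac (measure_mono_null (fun x hx => ?_) (Measure.addHaar_sphere volume 0 (r : ℝ)))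
    rw [mem_sphere_zero_iff_norm]
    exact congrArg NNReal.toReal hx
  obtain ⟨γ, hγ, δ, hδ, hsep⟩ := exists_separated_transportPlan N _ hatom
  have := hγ.1
  refine (iInf₂_le γ hγ).trans_lt ((lintegral_mono_ae (hsep.mono fun r hr =>
    reducedCost_le_of_separated hr)).trans_lt ?_)
  rw [lintegral_const, measure_univ, mul_one]
  have hδ' : 1 / ENNReal.ofReal δ < ∞ := ENNReal.div_lt_top ENNReal.one_ne_top (by simpa using hδ)
  exact ENNReal.mul_lt_top (ENNReal.natCast_lt_top N)
    (ENNReal.mul_lt_top (ENNReal.natCast_lt_top N) hδ')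

end Radial

theorem isOptimalPlan_iff_lintegral_le {X : Type*} [MeasurableSpace X] {N : ℕ} {μ : Measure X}
    {c : (Fin N → X) → ℝ≥0∞} {γ : Measure (Fin N → X)} (hγ : γ ∈ transportPlans N μ) :
    IsOptimalPlan N μ c γ ↔ ∫⁻ x, c x ∂γ ≤ transportValue N μ c := by
  simp [IsOptimalPlan, transportValue, hγ]

theorem mainTheorem1 (d N : ℕ) (hd : 1 ≤ d) (ρ : Measure (RSpace d)) [IsProbabilityMeasure ρ]
    (hρ : IsRadialMeasure ρ) :
    transportValue N ρ (coulombCost d N) =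
        transportValue N (radialMarginal ρ) (reducedCost d N) ∧
      (ρ ≪ volume ∨ transportValue N ρ (coulombCost d N) < ∞ →
        ∀ γ ∈ transportPlans N ρ,
          (IsOptimalPlan N ρ (coulombCost d N) γ ↔
            IsOptimalPlan N (radialMarginal ρ) (reducedCost d N) (radialComponent γ) ∧
              ∀ᵐ x ∂γ, coulombCost d N x = reducedCost d N (fun i => ‖x i‖₊))) := by
  have : Nonempty (Fin d) := ⟨⟨0, hd⟩⟩
  have heq := transportValue_coulombCost_eq (N := N) hρ
  refine ⟨heq, fun hfin γ hγ => ?_⟩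
  have hlt : transportValue N ρ (coulombCost d N) < ∞ :=
    hfin.elim (transportValue_lt_top_of_absolutelyContinuous hρ) id
  rw [isOptimalPlan_iff_lintegral_le hγ,
    isOptimalPlan_iff_lintegral_le (radialComponent_mem_transportPlans hγ), ← heq,
    lintegral_reducedCost_radialComponent]
  have hle : ∀ x, reducedCost d N (fun i => ‖x i‖₊) ≤ coulombCost d N x :=
    reducedCost_le_coulombCost
  refine ⟨fun h => ⟨(lintegral_mono hle).trans h, ?_⟩,
    fun h => (lintegral_congr_ae h.2).trans_le h.1⟩
  have hlow : transportValue N ρ (coulombCost d N) ≤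
      ∫⁻ x, reducedCost d N (fun i => ‖x i‖₊) ∂γ := by
    rw [heq, ← lintegral_reducedCost_radialComponent]
    exact iInf₂_le _ (radialComponent_mem_transportPlans hγ)
  -- Both integrals equal the transport value; its finiteness excludes `∞ = ∞`, which would say
  -- nothing pointwise.
  have hae := ae_eq_of_ae_le_of_lintegral_le (Filter.Eventually.of_forall hle)
    (((lintegral_mono hle).trans h).trans_lt hlt).ne
    (continuous_coulombCost d N).measurable.aemeasurable (h.trans hlow)
  exact hae.mono fun x hx => hx.symm
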